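/- Let $n \ge 0$ be an integer, let $\Sigma$ be a Cantor set (a non-empty, compact, totally disconnected metric space without isolated points), and let $\mathbb{Z}^n$ act on $\Sigma$ by homeomorphisms, freely and minimally (every orbit is dense). Let $X = \Sigma \times_{\mathbb{Z}^n} \mathbb{R}^n$ be the suspension, i.e. the quotient of $\Sigma \times \mathbb{R}^n$ by the diagonal action $m\cdot(x,w) = (m\cdot x, w+m)$ of $\mathbb{Z}^n$, with quotient map $\pi : \Sigma\times\mathbb{R}^n \to X$. Let $\mathcal{L} \subseteq \mathbb{R}^n$ be the union of all hyperplanes $\{w : w_i = k\}$, $1 \le i \le n$, $k \in \mathbb{Z}$, and let $A = \pi(\Sigma \times \mathcal{L}) \subseteq X$. Write $\check H^*(\,\cdot\,;\mathbb{R})$ for Čech cohomology with real coefficients. Then the map $$j^* : \check H^n(X/A;\mathbb{R}) \to \check H^n(X;\mathbb{R})$$ induced by the quotient map $X \to X/A$ is surjective, and so is the map $$j^* : \check H^n(X,A;\mathbb{R}) \to \check H^n(X;\mathbb{R})$$ of the long exact sequence of the pair $(X,A)$. -/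

import Mathlib

noncomputable section

open Classical in
/-- Decidable equality, needed by `Module.DirectLimit` on its index type. -/
abbrev classicalDecEq (ι : Type*) : DecidableEq ι := fun _ _ => inferInstance

namespace Cech

/-- An open cover of `X` indexed by the points of `X`, the set with index `x` being an open
neighbourhood of `x`.  Every open cover of `X` is refined by one of these, and the refinements
among them can be taken to be the identity on indices, so that the direct limit of the
cohomology of nerves over them is the direct limit over all open covers.  For a subset `A`, the
members whose index lies in `A` cover `A`, so these covers are also cofinal among the open covers
of the pair `(X, A)`. -/
structure PointedCover (X : Type*) [TopologicalSpace X] where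
  toFun : X → Set X
  isOpen' : ∀ x, IsOpen (toFun x)
  mem' : ∀ x, x ∈ toFun x

instance {X : Type*} [TopologicalSpace X] : CoeFun (PointedCover X) (fun _ => X → Set X) :=
  ⟨PointedCover.toFun⟩

/-- `U ≤ V` means that `V` refines `U`. -/
instance {X : Type*} [TopologicalSpace X] : Preorder (PointedCover X) where
  le U V := ∀ x, V x ⊆ U x
  le_refl _ _ := subset_rfl
  le_trans _ _ _ h₁ h₂ x := (h₂ x).trans (h₁ x)

/-- The pull-back of a pointed cover by a continuous map. -/
def PointedCover.comap {X Y : Type*} [TopologicalSpace X] [TopologicalSpace Y] (f : C(X, Y))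
    (U : PointedCover Y) : PointedCover X where
  toFun x := f ⁻¹' U (f x)
  isOpen' x := (U.isOpen' (f x)).preimage f.continuous
  mem' x := U.mem' (f x)

section Nerve

variable {X : Type*} [TopologicalSpace X]

/-- The (ordered, possibly degenerate) `p`-simplices of the nerve of `U`: the `(p + 1)`-tuples of
indices for which the corresponding members of `U` have a common point. -/
def Simplex (U : PointedCover X) (p : ℕ) : Type _ :=
  {s : Fin (p + 1) → X // (⋂ i, U (s i)).Nonempty}

/-- The simplices of the subcomplex of the nerve of `U` that belongs to `A`: all indices are in
`A`, and the corresponding members of `U` have a common point in `A`. -/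
def Simplex.MemSub {U : PointedCover X} (A : Set X) {p : ℕ} (s : Simplex U p) : Prop :=
  (∀ i, s.1 i ∈ A) ∧ (A ∩ ⋂ i, U (s.1 i)).Nonempty

/-- The face of a simplex opposite to its `k`-th vertex. -/
def Simplex.face {U : PointedCover X} {p : ℕ} (s : Simplex U (p + 1)) (k : Fin (p + 2)) :
    Simplex U p :=
  ⟨fun i => s.1 (k.succAbove i), by
    obtain ⟨y, hy⟩ := s.2
    rw [Set.mem_iInter] at hy
    exact ⟨y, Set.mem_iInter.2 fun i => hy _⟩⟩

theorem Simplex.MemSub.face {U : PointedCover X} {A : Set X} {p : ℕ} {s : Simplex U (p + 1)}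
    (h : s.MemSub A) (k : Fin (p + 2)) : (s.face k).MemSub A := by
  obtain ⟨h₁, y, hyA, hy⟩ := h
  rw [Set.mem_iInter] at hy
  exact ⟨fun i => h₁ _, y, hyA, Set.mem_iInter.2 fun i => hy _⟩

/-- The real simplicial `p`-cochains of the nerve of `U` that vanish on the subcomplex belonging
to `A`. -/
def cochainSubmodule (U : PointedCover X) (A : Set X) (p : ℕ) :
    Submodule ℝ (Simplex U p → ℝ) where
  carrier := {c | ∀ s, s.MemSub A → c s = 0}
  add_mem' ha hb s hs := by simp [ha s hs, hb s hs]
  zero_mem' _ _ := rfl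
  smul_mem' r c hc s hs := by simp [hc s hs]

/-- The real vector space of these cochains. -/
def Cochain (U : PointedCover X) (A : Set X) (p : ℕ) : Type _ := cochainSubmodule U A p

instance (U : PointedCover X) (A : Set X) (p : ℕ) : AddCommGroup (Cochain U A p) :=
  inferInstanceAs (AddCommGroup (cochainSubmodule U A p))

instance (U : PointedCover X) (A : Set X) (p : ℕ) : Module ℝ (Cochain U A p) :=
  inferInstanceAs (Module ℝ (cochainSubmodule U A p))

/-- The simplicial coboundary `(δ c)(s) = ∑ₖ (-1)ᵏ c(∂ₖ s)`. -/
def coboundary (U : PointedCover X) (A : Set X) (p : ℕ) :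
    Cochain U A p →ₗ[ℝ] Cochain U A (p + 1) where
  toFun c := ⟨fun s => ∑ k : Fin (p + 2), (-1 : ℝ) ^ (k : ℕ) * c.1 (s.face k), fun s hs =>
    Finset.sum_eq_zero fun k _ => by rw [c.2 _ (hs.face k), mul_zero]⟩
  map_add' c d := Subtype.ext <| funext fun s => by
    change ∑ k : Fin (p + 2), (-1 : ℝ) ^ (k : ℕ) * (c.1 (s.face k) + d.1 (s.face k)) =
      ∑ k : Fin (p + 2), (-1 : ℝ) ^ (k : ℕ) * c.1 (s.face k) +
        ∑ k : Fin (p + 2), (-1 : ℝ) ^ (k : ℕ) * d.1 (s.face k)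
    simp only [mul_add, Finset.sum_add_distrib]
  map_smul' r c := Subtype.ext <| funext fun s => by
    change ∑ k : Fin (p + 2), (-1 : ℝ) ^ (k : ℕ) * (r * c.1 (s.face k)) =
      r * ∑ k : Fin (p + 2), (-1 : ℝ) ^ (k : ℕ) * c.1 (s.face k)
    simp only [Finset.mul_sum, mul_left_comm]

/-- The `p`-cocycles. -/
abbrev cocycles (U : PointedCover X) (A : Set X) (p : ℕ) : Submodule ℝ (Cochain U A p) :=
  LinearMap.ker (coboundary U A p)

/-- The `p`-coboundaries. -/
def coboundaries (U : PointedCover X) (A : Set X) :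
    (p : ℕ) → Submodule ℝ (Cochain U A p)
  | 0 => ⊥
  | p + 1 => LinearMap.range (coboundary U A p)

/-- The `p`-th real simplicial cohomology of the nerve of `U` relative to the subcomplex
belonging to `A`: cocycles modulo coboundaries. -/
abbrev NerveCohomology (U : PointedCover X) (A : Set X) (p : ℕ) : Type _ :=
  cocycles U A p ⧸ (coboundaries U A p).comap (cocycles U A p).subtype

end Nerve

section Pull

variable {X Y : Type*} [TopologicalSpace X] [TopologicalSpace Y]

/-- The simplicial map of nerves defined by a map `f` on indices. -/
def Simplex.map (f : X → Y) {U : PointedCover Y} {V : PointedCover X}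
    (hUV : ∀ x, V x ⊆ f ⁻¹' U (f x)) {p : ℕ} (s : Simplex V p) : Simplex U p :=
  ⟨fun i => f (s.1 i), by
    obtain ⟨y, hy⟩ := s.2
    rw [Set.mem_iInter] at hy
    exact ⟨f y, Set.mem_iInter.2 fun i => hUV _ (hy i)⟩⟩

theorem Simplex.MemSub.map {f : X → Y} {U : PointedCover Y} {V : PointedCover X}
    {A : Set X} {B : Set Y} (hf : Set.MapsTo f A B)
    (hUV : ∀ x, V x ⊆ f ⁻¹' U (f x)) {p : ℕ} {s : Simplex V p} (h : s.MemSub A) :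
    (s.map f hUV).MemSub B := by
  obtain ⟨h₁, y, hyA, hy⟩ := h
  rw [Set.mem_iInter] at hy
  exact ⟨fun i => hf (h₁ i), f y, hf hyA, Set.mem_iInter.2 fun i => hUV _ (hy i)⟩

/-- Pull-back of cochains along a simplicial map of nerves. -/
def cochainPull {f : X → Y} {U : PointedCover Y} {V : PointedCover X}
    {A : Set X} {B : Set Y} (hf : Set.MapsTo f A B)
    (hUV : ∀ x, V x ⊆ f ⁻¹' U (f x)) (p : ℕ) : Cochain U B p →ₗ[ℝ] Cochain V A p where
  toFun c := ⟨fun s => c.1 (s.map f hUV), fun _ hs => c.2 _ (hs.map hf hUV)⟩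
  map_add' _ _ := rfl
  map_smul' _ _ := rfl

theorem coboundary_cochainPull {f : X → Y} {U : PointedCover Y} {V : PointedCover X}
    {A : Set X} {B : Set Y} (hf : Set.MapsTo f A B)
    (hUV : ∀ x, V x ⊆ f ⁻¹' U (f x)) (p : ℕ) (c : Cochain U B p) :
    coboundary V A p (cochainPull hf hUV p c) =
      cochainPull hf hUV (p + 1) (coboundary U B p c) := rfl

theorem cochainPull_mem_cocycles {f : X → Y} {U : PointedCover Y} {V : PointedCover X}
    {A : Set X} {B : Set Y} (hf : Set.MapsTo f A B)
    (hUV : ∀ x, V x ⊆ f ⁻¹' U (f x)) (p : ℕ) (c : Cochain U B p) (hc : c ∈ cocycles U B p) :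
    cochainPull hf hUV p c ∈ cocycles V A p := by
  rw [LinearMap.mem_ker] at hc ⊢
  rw [coboundary_cochainPull, hc, map_zero]

theorem cochainPull_mem_coboundaries {f : X → Y} {U : PointedCover Y} {V : PointedCover X}
    {A : Set X} {B : Set Y} (hf : Set.MapsTo f A B)
    (hUV : ∀ x, V x ⊆ f ⁻¹' U (f x)) (p : ℕ) (c : Cochain U B p)
    (hc : c ∈ coboundaries U B p) : cochainPull hf hUV p c ∈ coboundaries V A p := by
  cases p with
  | zero =>
    have h0 : c = 0 := hc
    rw [h0, map_zero]
    exact Submodule.zero_mem _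
  | succ p =>
    obtain ⟨d, rfl⟩ := hc
    exact ⟨cochainPull hf hUV p d, coboundary_cochainPull hf hUV p d⟩

/-- The map induced in cohomology by a simplicial map of nerves. -/
def nervePull {f : X → Y} {U : PointedCover Y} {V : PointedCover X}
    {A : Set X} {B : Set Y} (hf : Set.MapsTo f A B)
    (hUV : ∀ x, V x ⊆ f ⁻¹' U (f x)) (p : ℕ) :
    NerveCohomology U B p →ₗ[ℝ] NerveCohomology V A p :=
  Submodule.mapQ _ _
    ((cochainPull hf hUV p).restrict (cochainPull_mem_cocycles hf hUV p))
    (fun c hc => cochainPull_mem_coboundaries hf hUV p c.1 hc)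

/-- The map from the cohomology of the nerve of a cover to that of a refinement. -/
abbrev nerveRefine (A : Set X) (p : ℕ) (U V : PointedCover X) (h : U ≤ V) :
    NerveCohomology U A p →ₗ[ℝ] NerveCohomology V A p :=
  nervePull (f := id) (Set.mapsTo_id A) h p

end Pull

attribute [local instance] classicalDecEq

/-- The Čech cohomology `Ȟᵖ(X, A; ℝ)` of a pair: the direct limit, over the open covers of `X`
ordered by refinement, of the cohomology of the nerves relative to the subcomplexes belonging
to `A`. -/
abbrev RelCohomology (X : Type*) [TopologicalSpace X] (A : Set X) (p : ℕ) : Type _ :=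
  Module.DirectLimit (fun U : PointedCover X => NerveCohomology U A p) (nerveRefine A p)

/-- The Čech cohomology `Ȟᵖ(X; ℝ) = Ȟᵖ(X, ∅; ℝ)`. -/
abbrev Cohomology (X : Type*) [TopologicalSpace X] (p : ℕ) : Type _ :=
  RelCohomology X ∅ p

/-- The map `f^* : Ȟᵖ(Y, B; ℝ) → Ȟᵖ(X, A; ℝ)` induced by a continuous map of pairs
`f : (X, A) → (Y, B)`: on the nerve of a cover `U` of `Y` it is induced by the simplicial map
from the nerve of `f⁻¹ U` to that of `U`. -/
def relMap {X Y : Type*} [TopologicalSpace X] [TopologicalSpace Y] {A : Set X} {B : Set Y}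
    (f : C(X, Y)) (hf : Set.MapsTo f A B) (p : ℕ) :
    RelCohomology Y B p →ₗ[ℝ] RelCohomology X A p :=
  Module.DirectLimit.lift ℝ (PointedCover Y) _ _
    (fun U => (Module.DirectLimit.of ℝ (PointedCover X)
        (fun V : PointedCover X => NerveCohomology V A p) (nerveRefine A p) (U.comap f)).comp
      (nervePull (V := U.comap f) hf (fun _ => subset_rfl) p))
    (fun U V hUV c => by
      have hle : U.comap f ≤ V.comap f := fun x => Set.preimage_mono (hUV (f x))
      have key : nervePull (V := V.comap f) hf (fun _ => subset_rfl) p (nerveRefine B p U V hUV c)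
          = nerveRefine A p (U.comap f) (V.comap f) hle
              (nervePull (V := U.comap f) hf (fun _ => subset_rfl) p c) := by
        induction c using Submodule.Quotient.induction_on with
        | _ c => rfl
      simp only [LinearMap.comp_apply, key]
      exact Module.DirectLimit.of_f)

/-- The map `f^* : Ȟᵖ(Y; ℝ) → Ȟᵖ(X; ℝ)` induced by a continuous map `f : X → Y`. -/
abbrev map {X Y : Type*} [TopologicalSpace X] [TopologicalSpace Y] (f : C(X, Y)) (p : ℕ) :
    Cohomology Y p →ₗ[ℝ] Cohomology X p :=
  relMap f (Set.mapsTo_empty f ∅) p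

/-- The map `Ȟᵖ(X, A; ℝ) → Ȟᵖ(X; ℝ)` of the long exact sequence of the pair, induced by the
inclusion `(X, ∅) → (X, A)`. -/
abbrev relToAbs (X : Type*) [TopologicalSpace X] (A : Set X) (p : ℕ) :
    RelCohomology X A p →ₗ[ℝ] Cohomology X p :=
  relMap (ContinuousMap.id X) (Set.empty_subset A : Set.MapsTo id ∅ A) p

end Cech

/-- The equivalence relation that identifies all points of `A` with each other. -/
def collapseSetoid {X : Type*} (A : Set X) : Setoid X where
  r x y := x = y ∨ (x ∈ A ∧ y ∈ A)
  iseqv :=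
    { refl := fun _ => Or.inl rfl
      symm := fun h => h.imp Eq.symm And.symm
      trans := by
        rintro x y z (rfl | ⟨hx, hy⟩) (rfl | ⟨hy', hz⟩)
        · exact Or.inl rfl
        · exact Or.inr ⟨hy', hz⟩
        · exact Or.inr ⟨hx, hy⟩
        · exact Or.inr ⟨hx, hz⟩ }

/-- The space `X / A`, with the quotient topology (for non-empty `A`). -/
abbrev Collapse (X : Type*) [TopologicalSpace X] (A : Set X) : Type _ :=
  Quotient (collapseSetoid A)

/-- The quotient map `X → X / A`. -/
def collapseMap (X : Type*) [TopologicalSpace X] (A : Set X) : C(X, Collapse X A) where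
  toFun := Quotient.mk (collapseSetoid A)
  continuous_toFun := continuous_quotient_mk'

section Suspension

variable (n : ℕ) (S : Type*) [AddAction (Fin n → ℤ) S]

/-- The orbit relation of the diagonal action `m · (x, w) = (m · x, w + m)` of `ℤⁿ` on `S × ℝⁿ`. -/
def suspensionSetoid : Setoid (S × (Fin n → ℝ)) where
  r a b := ∃ m : Fin n → ℤ, b = (m +ᵥ a.1, fun i => a.2 i + (m i : ℝ))
  iseqv :=
    { refl := fun a => ⟨0, by simp⟩
      symm := by
        rintro a b ⟨m, rfl⟩
        exact ⟨-m, by simp⟩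
      trans := by
        rintro a b c ⟨m, rfl⟩ ⟨k, rfl⟩
        refine ⟨k + m, Prod.ext (add_vadd k m a.1).symm (funext fun i => ?_)⟩
        simp only [Pi.add_apply, Int.cast_add]
        ring }

/-- The suspension `S ×_{ℤⁿ} ℝⁿ`, with the quotient topology. -/
abbrev Suspension [TopologicalSpace S] : Type _ := Quotient (suspensionSetoid n S)

/-- The union of the hyperplanes in `ℝⁿ` that are orthogonal to a coordinate axis and pass through
a point of `ℤⁿ`. -/
def latticeHyperplanes : Set (Fin n → ℝ) := {w | ∃ i : Fin n, ∃ k : ℤ, w i = k}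

/-- The image in the suspension of `S` times the union of the lattice hyperplanes. -/
def suspensionSkeleton [TopologicalSpace S] : Set (Suspension n S) :=
  Quotient.mk (suspensionSetoid n S) '' (Set.univ ×ˢ latticeHyperplanes n)

end Suspension

end

/-! Heuristically, `A` has covering dimension less than `n`, so the `n`-th cohomology of `A`
vanishes and the long exact sequence gives surjectivity. The proof works on cocycles and avoids the
sequence: every `n`-cocycle on a nerve of `X` becomes, on a refinement, cohomologous to one that
vanishes on all simplices meeting a neighbourhood `N` of `A`. Such a cocycle is a relative cocycle
of `(X, A)` and also descends to `X/A`.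

Geometry (`Suspension.exists_refinement`): cut `X` along `n` shifted copies of a grid of side `1/M`.
The complement of each copy is a disjoint union of open pieces (cube times clopen set), small enough
to lie in members of the given cover. A point on all `n` copies has, by pigeonhole, every coordinate
on a shifted hyperplane, hence far from the unshifted grid, which contains `A`. So near `A` the `n`
families of pieces cover, with at most one piece of each family through a point.

Algebra (`ListChain.exists_homotopy`, `Cech.exists_cocycle_eq_zero`): if the `n + 1` vertices of a
simplex take at most `n` values under `r`, then pushing it along `r` and sorting gives zero.
Cochains here are neither alternating nor normalized, so sorting is realized by a chain map
homotopic to the identity, and the homotopy supplies the coboundary that corrects the cocycle. -/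

noncomputable section

/-! ### Ordered chains: cones, boundary and sorting. -/

namespace ListChain

open Finsupp

variable {J : Type*}

theorem eq_of_mem_supported {α M : Type*} [AddCommGroup M] [Module ℝ M] {s : Set α}
    {f g : (α →₀ ℝ) →ₗ[ℝ] M} (h : ∀ a ∈ s, f (single a 1) = g (single a 1)) {x : α →₀ ℝ}
    (hx : x ∈ supported ℝ ℝ s) : f x = g x := by
  rw [supported_eq_span_single] at hx
  refine LinearMap.eqOn_span ?_ hx
  rintro _ ⟨a, ha, rfl⟩
  exact h a ha

theorem map_mem_of_mem_supported {α M : Type*} [AddCommGroup M] [Module ℝ M] {s : Set α}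
    {f : (α →₀ ℝ) →ₗ[ℝ] M} {P : Submodule ℝ M} (h : ∀ a ∈ s, f (single a 1) ∈ P) {x : α →₀ ℝ}
    (hx : x ∈ supported ℝ ℝ s) : f x ∈ P := by
  rw [supported_eq_span_single] at hx
  have : Submodule.span ℝ ((fun i => single i 1) '' s) ≤ P.comap f := by
    rw [Submodule.span_le]
    rintro _ ⟨a, ha, rfl⟩
    exact h a ha
  exact this hx

/-- The cone with apex `a`. -/
def cone (a : J) : (List J →₀ ℝ) →ₗ[ℝ] (List J →₀ ℝ) := lmapDomain ℝ ℝ (List.cons a)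

@[simp]
theorem cone_single (a : J) (l : List J) (t : ℝ) : cone a (single l t) = single (a :: l) t :=
  mapDomain_single

/-- The boundary of a list, viewed as an ordered simplex of the augmented chain complex. -/
def listBoundary : List J → (List J →₀ ℝ)
  | [] => 0
  | a :: l => single l 1 - cone a (listBoundary l)

/-- The boundary of the augmented complex of ordered chains. -/
def boundary : (List J →₀ ℝ) →ₗ[ℝ] (List J →₀ ℝ) := linearCombination ℝ listBoundary

theorem boundary_single (l : List J) : boundary (single l 1) = listBoundary l := by
  simp [boundary]

theorem boundary_cone (a : J) (x : List J →₀ ℝ) :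
    boundary (cone a x) = x - cone a (boundary x) := by
  have : boundary ∘ₗ cone a = LinearMap.id - cone a ∘ₗ boundary := by
    ext l : 2
    simp [boundary_single, listBoundary]
  exact LinearMap.congr_fun this x

theorem boundary_listBoundary (l : List J) : boundary (listBoundary l) = 0 := by
  induction l with
  | nil => simp [listBoundary]
  | cons a l ih => simp [listBoundary, boundary_cone, boundary_single, ih]

/-- The lists of length `k` with members in `C`. -/
def tuples (k : ℕ) (C : Set J) : Set (List J) := {l | l.length = k ∧ ∀ a ∈ l, a ∈ C}

theorem cone_mem_supported {k : ℕ} {C : Set J} {a : J} (ha : a ∈ C) {x : List J →₀ ℝ}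
    (hx : x ∈ supported ℝ ℝ (tuples k C)) : cone a x ∈ supported ℝ ℝ (tuples (k + 1) C) := by
  refine map_mem_of_mem_supported (fun l hl => ?_) hx
  rw [cone_single]
  exact single_mem_supported ℝ _ ⟨by simp [hl.1], by simpa using ⟨ha, hl.2⟩⟩

theorem listBoundary_mem_supported {k : ℕ} {C : Set J} {l : List J} (hl : l ∈ tuples (k + 1) C) :
    listBoundary l ∈ supported ℝ ℝ (tuples k C) := by
  induction k generalizing l with
  | zero =>
    obtain ⟨a, rfl⟩ := List.length_eq_one_iff.1 hl.1
    simp only [listBoundary, map_zero, sub_zero]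
    exact single_mem_supported ℝ _ ⟨rfl, by simp⟩
  | succ k ih =>
    obtain ⟨a, t, rfl⟩ := List.exists_cons_of_length_eq_add_one hl.1
    have ht : t ∈ tuples (k + 1) C := ⟨by simpa using hl.1, fun b hb => hl.2 b (by simp [hb])⟩
    exact Submodule.sub_mem _ (single_mem_supported ℝ _ ht)
      (cone_mem_supported (hl.2 a (by simp)) (ih ht))

theorem mem_tuples_mem (l : List J) : l ∈ tuples l.length {a | a ∈ l} := ⟨rfl, fun _ h => h⟩

open Classical in
/-- The cone with apex `m`, set to be zero on lists that contain `m`. -/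
def reducedCone (m : J) : (List J →₀ ℝ) →ₗ[ℝ] (List J →₀ ℝ) :=
  linearCombination ℝ fun l => if m ∈ l then 0 else single (m :: l) 1

theorem reducedCone_single_of_mem {m : J} {l : List J} (h : m ∈ l) :
    reducedCone m (single l 1) = 0 := by
  simp [reducedCone, h]

theorem reducedCone_single_of_notMem {m : J} {l : List J} (h : m ∉ l) :
    reducedCone m (single l 1) = single (m :: l) 1 := by
  simp [reducedCone, h]

theorem reducedCone_eq_cone {m : J} {k : ℕ} {x : List J →₀ ℝ}
    (hx : x ∈ supported ℝ ℝ (tuples k {a | a ≠ m})) : reducedCone m x = cone m x :=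
  eq_of_mem_supported (fun l hl => by
    rw [cone_single, reducedCone_single_of_notMem fun h => hl.2 m h rfl]) hx

theorem reducedCone_cone (m : J) (x : List J →₀ ℝ) : reducedCone m (cone m x) = 0 := by
  have : reducedCone m ∘ₗ cone m = 0 := by
    ext l : 2
    simp [reducedCone_single_of_mem]
  exact LinearMap.congr_fun this x

/-- The chain map that pushes a list forward along a map to a linear order, and then makes it a
chain of strictly decreasing lists by coning off the largest member `top l` inductively. -/
def sortMap (top : List J → J) : ℕ → (List J →₀ ℝ) →ₗ[ℝ] (List J →₀ ℝ)
  | 0 => LinearMap.id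
  | k + 1 => linearCombination ℝ fun l => reducedCone (top l) (sortMap top k (listBoundary l))

theorem sortMap_succ_single (top : List J → J) (k : ℕ) (l : List J) :
    sortMap top (k + 1) (single l 1) = reducedCone (top l) (sortMap top k (listBoundary l)) := by
  simp [sortMap]

/-- A chain homotopy between the identity and `sortMap`. -/
def homotopy (top : List J → J) : ℕ → (List J →₀ ℝ) →ₗ[ℝ] (List J →₀ ℝ)
  | 0 => 0
  | k + 1 => linearCombination ℝ fun l => match l with
    | [] => 0
    | a :: t => cone a (single (a :: t) 1 - sortMap top (k + 1) (single (a :: t) 1)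
        - homotopy top k (listBoundary (a :: t)))

theorem homotopy_succ_single (top : List J → J) (k : ℕ) (a : J) (t : List J) :
    homotopy top (k + 1) (single (a :: t) 1) =
      cone a (single (a :: t) 1 - sortMap top (k + 1) (single (a :: t) 1)
        - homotopy top k (listBoundary (a :: t))) := by
  simp [homotopy]

section Order

variable [LinearOrder J]

/-- The strictly decreasing lists of length `k` with members in `C`. -/
def decreasing (k : ℕ) (C : Set J) : Set (List J) := {l | l ∈ tuples k C ∧ l.Pairwise (· > ·)}

/-- If `m` heads the list, coning kills the list and its faces through `m`, leaving the face without
`m`, which is coned back to the list. Otherwise `m` does not occur and this is the ordinary cone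
identity. Thus decreasing chains bounded by `m` are contractible. -/
theorem boundary_reducedCone {m : J} {k : ℕ} {x : List J →₀ ℝ}
    (hx : x ∈ supported ℝ ℝ (decreasing k (Set.Iic m))) :
    boundary (reducedCone m x) + reducedCone m (boundary x) = x := by
  refine eq_of_mem_supported (f := boundary ∘ₗ reducedCone m + reducedCone m ∘ₗ boundary)
    (g := LinearMap.id) (fun l hl => ?_) hx
  obtain ⟨⟨-, hC⟩, hl⟩ := hl
  simp only [LinearMap.add_apply, LinearMap.comp_apply, LinearMap.id_apply, boundary_single]
  cases l with
  | nil =>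
    rw [reducedCone_single_of_notMem (by simp), boundary_single]
    simp [listBoundary]
  | cons a t =>
    have hlt : ∀ b ∈ t, b < a := (List.pairwise_cons.1 hl).1
    have ham : a ≤ m := hC a (by simp)
    -- The empty list is separate because its boundary is zero by convention, not a chain of shorter
    -- lists.
    have key : ∀ l : List J, (∀ b ∈ l, b ≠ m) →
        reducedCone m (listBoundary l) = cone m (listBoundary l) := by
      intro l hlm
      cases l with
      | nil => simp [listBoundary]
      | cons b l => exact reducedCone_eq_cone (listBoundary_mem_supported ⟨rfl, hlm⟩)
    obtain rfl | hne := eq_or_ne a m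
    · rw [reducedCone_single_of_mem (by simp), map_zero, zero_add, listBoundary, map_sub,
        reducedCone_cone, sub_zero, reducedCone_single_of_notMem]
      exact fun h => (hlt a h).false
    · have hat : ∀ b ∈ a :: t, b ≠ m := by
        intro b hb
        rcases List.mem_cons.1 hb with rfl | hb
        · exact hne
        · exact ((hlt b hb).trans_le ham).ne
      rw [reducedCone_single_of_notMem fun h => hat m h rfl, key _ hat, boundary_single]
      simp [listBoundary]

theorem reducedCone_mem_supported {m : J} {k : ℕ} {C : Set J} (hC : ∀ a ∈ C, a ≤ m) (hm : m ∈ C)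
    {x : List J →₀ ℝ} (hx : x ∈ supported ℝ ℝ (decreasing k C)) :
    reducedCone m x ∈ supported ℝ ℝ (decreasing (k + 1) C) := by
  refine map_mem_of_mem_supported (fun l hl => ?_) hx
  by_cases h : m ∈ l
  · rw [reducedCone_single_of_mem h]
    exact Submodule.zero_mem _
  · rw [reducedCone_single_of_notMem h]
    refine single_mem_supported ℝ _ ⟨⟨by simp [hl.1.1], by simpa using ⟨hm, hl.1.2⟩⟩, ?_⟩
    exact List.pairwise_cons.2 ⟨fun b hb => lt_of_le_of_ne (hC b (hl.1.2 b hb)) fun e => h (e ▸ hb),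
      hl.2⟩

/-- `top l` is the largest value of `r` on the members of `l`. -/
def IsTop (r : J → J) (top : List J → J) : Prop :=
  ∀ l : List J, l ≠ [] → top l ∈ r '' {a | a ∈ l} ∧ ∀ a ∈ l, r a ≤ top l

variable {r : J → J} {top : List J → J}

theorem sortMap_mem_supported (htop : IsTop r top) {k : ℕ} {C : Set J} {x : List J →₀ ℝ}
    (hx : x ∈ supported ℝ ℝ (tuples k C)) :
    sortMap top k x ∈ supported ℝ ℝ (decreasing k (r '' C)) := by
  induction k generalizing C x with
  | zero =>
    refine map_mem_of_mem_supported (fun l hl => ?_) hx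
    obtain rfl := List.length_eq_zero_iff.1 hl.1
    exact single_mem_supported ℝ _ ⟨⟨rfl, by simp⟩, by simp⟩
  | succ k ih =>
    refine map_mem_of_mem_supported (fun l hl => ?_) hx
    rw [sortMap_succ_single]
    obtain ⟨ht, hle⟩ := htop l (by rintro rfl; simpa using hl.1)
    have hl' : l ∈ tuples (k + 1) {a | a ∈ l} := ⟨hl.1, fun _ h => h⟩
    refine supported_mono ?_ (reducedCone_mem_supported (C := r '' {a | a ∈ l}) ?_ ht
      (ih (listBoundary_mem_supported hl')))
    · refine fun t h => ⟨⟨h.1.1, fun a ha => ?_⟩, h.2⟩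
      obtain ⟨b, hb, rfl⟩ := h.1.2 a ha
      exact ⟨b, hl.2 b hb, rfl⟩
    · rintro _ ⟨a, ha, rfl⟩
      exact hle a ha

/-- By `boundary_reducedCone`, the two sides differ on `l` by the reduced cone over the boundary of
the sorted `∂l`; inductively that boundary is the sorted `∂∂l`, which is zero. -/
theorem boundary_sortMap (htop : IsTop r top) {k : ℕ} {C : Set J} {x : List J →₀ ℝ}
    (hx : x ∈ supported ℝ ℝ (tuples (k + 1) C)) :
    boundary (sortMap top (k + 1) x) = sortMap top k (boundary x) := by
  induction k generalizing C x with
  | zero =>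
    refine eq_of_mem_supported (f := boundary ∘ₗ sortMap top 1)
      (g := sortMap top 0 ∘ₗ boundary) (fun l hl => ?_) hx
    obtain ⟨a, rfl⟩ := List.length_eq_one_iff.1 hl.1
    simp only [LinearMap.comp_apply, sortMap_succ_single, boundary_single]
    simp [sortMap, listBoundary, reducedCone_single_of_notMem, boundary_single]
  | succ k ih =>
    refine eq_of_mem_supported (f := boundary ∘ₗ sortMap top (k + 2))
      (g := sortMap top (k + 1) ∘ₗ boundary) (fun l hl => ?_) hx
    simp only [LinearMap.comp_apply, boundary_single]
    rw [sortMap_succ_single]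
    have hl' : l ∈ tuples (k + 2) {a | a ∈ l} := ⟨hl.1, fun _ h => h⟩
    obtain ⟨-, hle⟩ := htop l (by rintro rfl; simpa using hl.1)
    have hb := listBoundary_mem_supported hl'
    have hs : sortMap top (k + 1) (listBoundary l) ∈
        supported ℝ ℝ (decreasing (k + 1) (Set.Iic (top l))) := by
      refine supported_mono ?_ (sortMap_mem_supported htop hb)
      refine fun t h => ⟨⟨h.1.1, fun a ha => ?_⟩, h.2⟩
      obtain ⟨b, hb, rfl⟩ := h.1.2 a ha
      exact hle b hb
    have := boundary_reducedCone hs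
    rwa [ih hb, boundary_listBoundary, map_zero, map_zero, add_zero] at this

/-- Sorted chains consist of strictly decreasing lists of values of `r`; too few values leave no
such list of the required length. -/
theorem sortMap_eq_zero (htop : IsTop r top) {l : List J} {T : Finset J} (hT : ∀ a ∈ l, r a ∈ T)
    (hc : T.card < l.length) : sortMap top l.length (single l 1) = 0 := by
  have h := sortMap_mem_supported htop (single_mem_supported ℝ (1 : ℝ) (mem_tuples_mem l))
  have he : decreasing l.length (r '' {a | a ∈ l}) = ∅ := by
    rw [Set.eq_empty_iff_forall_notMem]
    rintro t ⟨⟨ht, htl⟩, hp⟩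
    have hn : t.Nodup := hp.imp fun h => h.ne'
    have : t.toFinset ⊆ T := by
      intro a ha
      obtain ⟨b, hb, rfl⟩ := htl a (List.mem_toFinset.1 ha)
      exact hT b hb
    have := Finset.card_le_card this
    rw [List.toFinset_card_of_nodup hn] at this
    omega
  rw [he, supported_empty] at h
  exact h

/-- Carrier control: if all members and their images are cover indices at a common point, the
homotopy again yields simplices of the nerve. -/
theorem homotopy_mem_supported (htop : IsTop r top) {k : ℕ} {C C' : Set J} (hCC : C ⊆ C')
    (hC : Set.MapsTo r C C') {x : List J →₀ ℝ} (hx : x ∈ supported ℝ ℝ (tuples k C)) :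
    homotopy top k x ∈ supported ℝ ℝ (tuples (k + 1) C') := by
  induction k generalizing x with
  | zero => exact Submodule.zero_mem _
  | succ k ih =>
    refine map_mem_of_mem_supported (fun l hl => ?_) hx
    obtain ⟨a, t, rfl⟩ := List.exists_cons_of_length_eq_add_one hl.1
    rw [homotopy_succ_single]
    have hs := single_mem_supported ℝ (1 : ℝ) hl
    have hs' : single (a :: t) (1 : ℝ) ∈ supported ℝ ℝ (tuples (k + 1) C') :=
      single_mem_supported ℝ _ ⟨hl.1, fun b hb => hCC (hl.2 b hb)⟩
    refine cone_mem_supported (hCC (hl.2 a (by simp))) (Submodule.sub_mem _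
      (Submodule.sub_mem _ hs' ?_)
      (ih (listBoundary_mem_supported hl)))
    refine supported_mono ?_ (sortMap_mem_supported htop hs)
    rintro u ⟨⟨h1, h2⟩, -⟩
    exact ⟨h1, fun b hb => hC.image_subset (h2 b hb)⟩

/-- The chain that gets coned off is a cycle, by induction and `boundary_sortMap`, so the boundary
of its cone is the chain itself. -/
theorem boundary_homotopy (htop : IsTop r top) {k : ℕ} {C : Set J} {x : List J →₀ ℝ}
    (hx : x ∈ supported ℝ ℝ (tuples (k + 1) C)) :
    boundary (homotopy top (k + 1) x) =
      x - sortMap top (k + 1) x - homotopy top k (boundary x) := by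
  induction k generalizing C x with
  | zero =>
    refine eq_of_mem_supported (f := boundary ∘ₗ homotopy top 1)
      (g := LinearMap.id - sortMap top 1 - homotopy top 0 ∘ₗ boundary) (fun l hl => ?_) hx
    have hs := single_mem_supported ℝ (1 : ℝ) hl
    obtain ⟨a, t, rfl⟩ := List.exists_cons_of_length_eq_add_one hl.1
    simp only [LinearMap.comp_apply, LinearMap.sub_apply, LinearMap.id_apply, boundary_single]
    rw [homotopy_succ_single, boundary_cone]
    simp only [map_sub, boundary_sortMap htop hs]
    simp [homotopy, sortMap]
  | succ k ih =>
    refine eq_of_mem_supported (f := boundary ∘ₗ homotopy top (k + 2))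
      (g := LinearMap.id - sortMap top (k + 2) - homotopy top (k + 1) ∘ₗ boundary)
      (fun l hl => ?_) hx
    have hs := single_mem_supported ℝ (1 : ℝ) hl
    obtain ⟨a, t, rfl⟩ := List.exists_cons_of_length_eq_add_one hl.1
    simp only [LinearMap.comp_apply, LinearMap.sub_apply, LinearMap.id_apply, boundary_single]
    rw [homotopy_succ_single, boundary_cone]
    simp only [map_sub, boundary_sortMap htop hs, ih (listBoundary_mem_supported hl),
      boundary_listBoundary, boundary_single]
    simp

end Order

/-- On lists of length `k + 1` on which `r` takes at most `k` values, the identity of the complex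
of ordered chains is homotopic to zero, by a homotopy that only involves the members of a list and
their images under `r`. -/
theorem exists_homotopy [Nonempty J] (r : J → J) (k : ℕ) :
    ∃ D D' : (List J →₀ ℝ) →ₗ[ℝ] (List J →₀ ℝ),
      (∀ C C' : Set J, C ⊆ C' → Set.MapsTo r C C' → ∀ x ∈ supported ℝ ℝ (tuples (k + 1) C),
        D' x ∈ supported ℝ ℝ (tuples (k + 2) C')) ∧
      ∀ (l : List J) (T : Finset J), l.length = k + 1 → (∀ a ∈ l, r a ∈ T) → T.card ≤ k →
        boundary (D' (single l 1)) = single l 1 - D (listBoundary l) := by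
  -- Any linear order serves; only finite sets of values are compared.
  let _ : LinearOrder J := IsWellOrder.linearOrder (WellOrderingRel (α := J))
  have : ∀ l : List J, ∃ m, l ≠ [] → m ∈ r '' {a | a ∈ l} ∧ ∀ a ∈ l, r a ≤ m := by
    intro l
    by_cases hl : l = []
    · exact ⟨Classical.arbitrary J, fun h => absurd hl h⟩
    · obtain ⟨m, hm, h⟩ := l.toFinset.exists_max_image r (by simpa using hl)
      exact ⟨r m, fun _ => ⟨⟨m, by simpa using hm, rfl⟩, fun a ha => h a (by simpa using ha)⟩⟩
  choose top htop using this
  refine ⟨homotopy top k, homotopy top (k + 1),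
    fun C C' hCC hC x hx => homotopy_mem_supported htop hCC hC hx, fun l T hl hT hc => ?_⟩
  have hs := single_mem_supported ℝ (1 : ℝ) (mem_tuples_mem l)
  rw [hl] at hs
  rw [boundary_homotopy htop hs, boundary_single, ← hl, sortMap_eq_zero htop hT (by omega),
    sub_zero]

/-- The boundary of a list in terms of its faces. -/
theorem listBoundary_ofFn (p : ℕ) (s : Fin (p + 1) → J) :
    listBoundary (List.ofFn s) =
      ∑ k : Fin (p + 1), (-1 : ℝ) ^ (k : ℕ) • single (List.ofFn (s ∘ k.succAbove)) 1 := by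
  induction p with
  | zero => simp [List.ofFn_succ, listBoundary]
  | succ p ih =>
    rw [List.ofFn_succ, listBoundary, ih, Fin.sum_univ_succ (n := p + 1), map_sum, sub_eq_add_neg,
      ← Finset.sum_neg_distrib]
    congr 1
    · simp [Function.comp_def]
    · refine Finset.sum_congr rfl fun k _ => ?_
      rw [map_smul, cone_single, Fin.val_succ, pow_succ, mul_neg_one, neg_smul, List.ofFn_succ
        (f := s ∘ k.succ.succAbove)]
      simp [Function.comp_def]

end ListChain

/-! ### Cochains evaluated on chains, and cocycles made to vanish near a set. -/

namespace Cech

open Finsupp ListChain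

variable {X : Type*} [TopologicalSpace X]

open Classical in
/-- A cochain as a function on lists of indices, zero on those that are not simplices. -/
def Cochain.onList {U : PointedCover X} {A : Set X} {p : ℕ} (c : Cochain U A p) (l : List X) : ℝ :=
  if h : ∃ s : Simplex U p, List.ofFn s.1 = l then c.1 h.choose else 0

theorem Cochain.onList_ofFn {U : PointedCover X} {A : Set X} {p : ℕ} (c : Cochain U A p)
    (s : Simplex U p) : c.onList (List.ofFn s.1) = c.1 s := by
  have h : ∃ t : Simplex U p, List.ofFn t.1 = List.ofFn s.1 := ⟨s, rfl⟩
  rw [Cochain.onList, dif_pos h]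
  exact congrArg c.1 (Subtype.ext (List.ofFn_injective h.choose_spec))

/-- The linear extension of a cochain to chains of lists. -/
def Cochain.eval {U : PointedCover X} {A : Set X} {p : ℕ} (c : Cochain U A p) :
    (List X →₀ ℝ) →ₗ[ℝ] ℝ := linearCombination ℝ c.onList

theorem Cochain.eval_single {U : PointedCover X} {A : Set X} {p : ℕ} (c : Cochain U A p)
    (s : Simplex U p) : c.eval (single (List.ofFn s.1) 1) = c.1 s := by
  rw [Cochain.eval, linearCombination_single, one_smul, c.onList_ofFn]

theorem exists_simplex_of_mem_tuples {U : PointedCover X} {p : ℕ} {y : X} {l : List X}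
    (hl : l ∈ tuples (p + 1) {a | y ∈ U a}) : ∃ s : Simplex U p, List.ofFn s.1 = l := by
  obtain ⟨hlen, hl⟩ := hl
  obtain rfl : p = l.length - 1 := by omega
  have h : l.length - 1 + 1 = l.length := by omega
  refine ⟨⟨fun i => l.get (i.cast h), y, Set.mem_iInter.2 fun i => hl _ (List.get_mem _ _)⟩, ?_⟩
  refine List.ext_get (by rw [List.length_ofFn, h]) fun k h1 h2 => ?_
  simp only [List.get_ofFn]
  rfl

theorem coboundary_apply {U : PointedCover X} {A : Set X} {p : ℕ} (c : Cochain U A p)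
    (s : Simplex U (p + 1)) :
    (coboundary U A p c).1 s = c.eval (listBoundary (List.ofFn s.1)) := by
  rw [listBoundary_ofFn, map_sum]
  change ∑ k : Fin (p + 2), (-1 : ℝ) ^ (k : ℕ) * c.1 (s.face k) = _
  refine Finset.sum_congr rfl fun k _ => ?_
  rw [map_smul, smul_eq_mul]
  exact congrArg _ (c.eval_single (s.face k)).symm

theorem Simplex.ofFn_mem_tuples {U : PointedCover X} {p : ℕ} {s : Simplex U p} {y : X}
    (hs : y ∈ ⋂ i, U (s.1 i)) : List.ofFn s.1 ∈ tuples (p + 1) {a | y ∈ U a} := by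
  rw [Set.mem_iInter] at hs
  refine ⟨List.length_ofFn, fun a ha => ?_⟩
  obtain ⟨i, rfl⟩ := (List.mem_ofFn' _ _).1 ha
  exact hs i

theorem coboundary_coboundary {U : PointedCover X} {A : Set X} {p : ℕ} (c : Cochain U A p) :
    coboundary U A (p + 1) (coboundary U A p c) = 0 := by
  refine Subtype.ext (funext fun s => ?_)
  obtain ⟨y, hy⟩ := s.2
  rw [coboundary_apply]
  refine (eq_of_mem_supported (g := c.eval ∘ₗ boundary) (fun l hl => ?_)
    (listBoundary_mem_supported (Simplex.ofFn_mem_tuples hy))).trans ?_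
  · obtain ⟨t, rfl⟩ := exists_simplex_of_mem_tuples hl
    rw [Cochain.eval_single, coboundary_apply, LinearMap.comp_apply, boundary_single]
  · rw [LinearMap.comp_apply, boundary_listBoundary, map_zero]
    rfl

/-- Lists of indices of sets through one point `y` are simplices, so the cocycle condition applies
to each term. -/
theorem eval_boundary_eq_zero {U : PointedCover X} {A : Set X} {p : ℕ} {c : Cochain U A p}
    (hc : c ∈ cocycles U A p) {y : X} {x : List X →₀ ℝ}
    (hx : x ∈ supported ℝ ℝ (tuples (p + 2) {a | y ∈ U a})) : c.eval (boundary x) = 0 := by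
  refine eq_of_mem_supported (f := c.eval ∘ₗ boundary) (g := 0) (fun l hl => ?_) hx
  obtain ⟨s, rfl⟩ := exists_simplex_of_mem_tuples (p := p + 1) hl
  rw [LinearMap.comp_apply, boundary_single, ← coboundary_apply, LinearMap.mem_ker.1 hc]
  rfl

/-- Suppose that a refinement of `U` is refined by `V` in such a way that at most `n` of its members
are needed at each point of `N`.  Then on `V` each `n`-cocycle of `U` is cohomologous to one that
vanishes on all simplices that meet `N`. -/
theorem exists_cocycle_eq_zero {U V : PointedCover X} (hUV : U ≤ V) {n : ℕ} {c : Cochain U ∅ n}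
    (hc : c ∈ cocycles U ∅ n) (r : X → X) {N : Set X}
    (hN : ∀ y ∈ N, ∃ T : Finset X, T.card ≤ n ∧ ∀ x, y ∈ V x → r x ∈ T ∧ y ∈ U (r x)) :
    ∃ c' ∈ cocycles V ∅ n,
      cochainPull (f := id) (Set.mapsTo_id ∅) hUV n c - c' ∈ coboundaries V ∅ n ∧
      ∀ s : Simplex V n, (N ∩ ⋂ i, V (s.1 i)).Nonempty → c'.1 s = 0 := by
  have hpull := cochainPull_mem_cocycles (Set.mapsTo_id ∅) hUV n c hc
  cases n with
  | zero =>
    refine ⟨_, hpull, ?_, fun s ⟨y, hy, hs⟩ => ?_⟩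
    · rw [sub_self]
      exact Submodule.zero_mem _
    · obtain ⟨T, hT, h⟩ := hN y hy
      -- In degree `0` the set `N` must be empty, since `y ∈ V y` would force an element of `T`.
      obtain rfl : T = ∅ := by simpa using hT
      exact absurd (h y (V.mem' y)).1 (by simp)
  | succ m =>
    cases isEmpty_or_nonempty X with
    | inl hX => exact ⟨_, hpull, by rw [sub_self]; exact Submodule.zero_mem _,
        fun s => (hX.false (s.1 0)).elim⟩
    | inr hX =>
    obtain ⟨D, D', hD', hD⟩ := exists_homotopy r (m + 1)
    -- Away from `N` the homotopy may leave the nerve of `U`, where `eval` uses the default value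
    -- `0`. This is harmless: `b` only has to be some cochain.
    let b : Cochain V ∅ m := ⟨fun s => c.eval (D (single (List.ofFn s.1) 1)),
      fun s hs => absurd hs.2 (by simp)⟩
    have hb : ∀ s : Simplex V (m + 1), (coboundary V ∅ m b).1 s =
        c.eval (D (listBoundary (List.ofFn s.1))) := by
      intro s
      rw [listBoundary_ofFn, map_sum, map_sum]
      change ∑ k : Fin (m + 2), (-1 : ℝ) ^ (k : ℕ) * b.1 (s.face k) = _
      refine Finset.sum_congr rfl fun k _ => ?_
      rw [map_smul, map_smul]
      rfl
    refine ⟨cochainPull (f := id) (Set.mapsTo_id ∅) hUV (m + 1) c - coboundary V ∅ m b,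
      Submodule.sub_mem _ hpull ?_, ?_, fun s ⟨y, hy, hs⟩ => ?_⟩
    · rw [LinearMap.mem_ker, coboundary_coboundary]
    · rw [sub_sub_cancel]
      exact ⟨b, rfl⟩
    · obtain ⟨T, hT, h⟩ := hN y hy
      have hl := Simplex.ofFn_mem_tuples hs
      -- At `y ∈ N` both the identity and `r` send indices of `V` at `y` to indices of `U` at `y`,
      -- so the homotopy stays among simplices of `U`.
      have h1 := eval_boundary_eq_zero hc (y := y) (hD' {a | y ∈ V a} {a | y ∈ U a}
        (fun a ha => hUV a ha) (fun a ha => (h a ha).2) _ (single_mem_supported ℝ (1 : ℝ) hl))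
      rw [hD _ T hl.1 (fun a ha => (h a (hl.2 a ha)).1) hT, map_sub, ← hb] at h1
      rw [← h1]
      exact congrArg (· - _) (c.eval_single (s.map id hUV)).symm
end Cech

/-! ### Classes in the limit, and descent to the pair and to the collapsed space. -/

namespace Cech

attribute [local instance] classicalDecEq

variable {X : Type*} [TopologicalSpace X]

instance : Nonempty (PointedCover X) := ⟨⟨fun _ => Set.univ, fun _ => isOpen_univ, fun _ => trivial⟩⟩

instance : IsDirectedOrder (PointedCover X) where
  directed U V := ⟨⟨fun x => U x ∩ V x, fun x => (U.isOpen' x).inter (V.isOpen' x),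
    fun x => ⟨U.mem' x, V.mem' x⟩⟩, fun _ => Set.inter_subset_left, fun _ => Set.inter_subset_right⟩

/-- The cohomology class of a cocycle on the nerve of a cover. -/
def classOf {U : PointedCover X} {A : Set X} {p : ℕ} (c : Cochain U A p)
    (hc : c ∈ cocycles U A p) : RelCohomology X A p :=
  Module.DirectLimit.of ℝ (PointedCover X) (fun U => NerveCohomology U A p) (nerveRefine A p) U
    (Submodule.Quotient.mk ⟨c, hc⟩)

theorem exists_classOf {A : Set X} {p : ℕ} (z : RelCohomology X A p) :
    ∃ (U : PointedCover X) (c : Cochain U A p) (hc : c ∈ cocycles U A p), classOf c hc = z := by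
  obtain ⟨U, x, rfl⟩ := Module.DirectLimit.exists_of z
  induction x using Submodule.Quotient.induction_on with
  | _ c => exact ⟨U, c.1, c.2, rfl⟩

theorem classOf_refine {U V : PointedCover X} {A : Set X} {p : ℕ} (h : U ≤ V) (c : Cochain U A p)
    (hc : c ∈ cocycles U A p) :
    classOf (cochainPull (f := id) (Set.mapsTo_id A) h p c)
      (cochainPull_mem_cocycles (Set.mapsTo_id A) h p c hc) = classOf c hc :=
  Module.DirectLimit.of_f (f := nerveRefine A p) (hij := h) (x := Submodule.Quotient.mk ⟨c, hc⟩)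

theorem classOf_eq_of_sub_mem {U : PointedCover X} {A : Set X} {p : ℕ} {c d : Cochain U A p}
    (hc : c ∈ cocycles U A p) (hd : d ∈ cocycles U A p) (h : c - d ∈ coboundaries U A p) :
    classOf c hc = classOf d hd :=
  congrArg (Module.DirectLimit.of ℝ (PointedCover X) (fun U => NerveCohomology U A p)
    (nerveRefine A p) U) ((Submodule.Quotient.eq _).2 h)

theorem relMap_classOf {Y : Type*} [TopologicalSpace Y] {A : Set X} {B : Set Y} (f : C(X, Y))
    (hf : Set.MapsTo f A B) {p : ℕ} {U : PointedCover Y} (c : Cochain U B p)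
    (hc : c ∈ cocycles U B p) :
    relMap f hf p (classOf c hc) =
      classOf (U := U.comap f) (cochainPull hf (fun _ => subset_rfl) p c)
        (cochainPull_mem_cocycles hf _ p c hc) :=
  Module.DirectLimit.lift_of _ _ _

theorem classOf_mem_range_relToAbs {A N : Set X} (hAN : A ⊆ N) {V : PointedCover X} {n : ℕ}
    {c : Cochain V ∅ n} (hc : c ∈ cocycles V ∅ n)
    (hN : ∀ s : Simplex V n, (N ∩ ⋂ i, V (s.1 i)).Nonempty → c.1 s = 0) :
    classOf c hc ∈ Set.range (relToAbs X A n) := by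
  let c' : Cochain V A n := ⟨c.1, fun s hs => hN s (hs.2.mono (Set.inter_subset_inter_left _ hAN))⟩
  have hc' : c' ∈ cocycles V A n := by
    rw [LinearMap.mem_ker] at hc ⊢
    exact Subtype.ext (congrArg Subtype.val hc :)
  exact ⟨classOf c' hc', relMap_classOf _ _ c' hc'⟩

theorem collapseMap_eq_iff {A : Set X} {x y : X} :
    collapseMap X A x = collapseMap X A y ↔ x = y ∨ x ∈ A ∧ y ∈ A :=
  Quotient.eq (r := collapseSetoid A)

/-- Under either alternative `O` is saturated for the collapse. -/
theorem isOpen_collapseMap_image {A O : Set X} (hO : IsOpen O) (h : A ⊆ O ∨ Disjoint A O) :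
    IsOpen (collapseMap X A '' O) := by
  have : collapseMap X A ⁻¹' (collapseMap X A '' O) = O := by
    refine Set.Subset.antisymm ?_ (Set.subset_preimage_image _ _)
    rintro x ⟨y, hy, hxy⟩
    rcases collapseMap_eq_iff.1 hxy with rfl | ⟨hyA, hxA⟩
    · exact hy
    · exact h.elim (fun h => h hxA) fun h => (Set.disjoint_left.1 h hyA hy).elim
  exact (isQuotientMap_quotient_mk' (s := collapseSetoid A)).isOpen_preimage.1
    ((congrArg IsOpen this).mpr hO)

-- The quotient map is injective off `A`, so the cover and the cocycle are transported there and `N`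
-- covers the collapsed point. Extending the cocycle by zero is consistent because it already
-- vanishes on simplices meeting `N`.
open Classical in
theorem classOf_mem_range_map_collapse {A N : Set X} (hA : IsClosed A) (hNo : IsOpen N)
    (hAN : A ⊆ N) {V : PointedCover X} {n : ℕ} {c : Cochain V ∅ n} (hc : c ∈ cocycles V ∅ n)
    (hN : ∀ s : Simplex V n, (N ∩ ⋂ i, V (s.1 i)).Nonempty → c.1 s = 0) :
    classOf c hc ∈ Set.range (map (collapseMap X A) n) := by
  set q := collapseMap X A with hq
  let o : Collapse X A → X := Quotient.out
  have hqo : ∀ y, q (o y) = y := Quotient.out_eq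
  have hoA : ∀ x, o (q x) ∈ A ↔ x ∈ A := fun x => by
    rcases collapseMap_eq_iff.1 (hqo (q x)) with h | h
    · rw [h]
    · simp [h]
  have hoq : ∀ x, x ∉ A → o (q x) = x := fun x hx => by
    rcases collapseMap_eq_iff.1 (hqo (q x)) with h | h
    · exact h
    · exact absurd h.2 hx
  let W : PointedCover (Collapse X A) :=
    { toFun y := if o y ∈ A then q '' N else q '' (V (o y) \ A)
      isOpen' y := by
        split_ifs
        · exact isOpen_collapseMap_image hNo (Or.inl hAN)
        · exact isOpen_collapseMap_image ((V.isOpen' _).sdiff hA) (Or.inr Set.disjoint_sdiff_right)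
      mem' y := by
        split_ifs with h
        · exact ⟨o y, hAN h, hqo y⟩
        · exact ⟨o y, ⟨V.mem' _, h⟩, hqo y⟩ }
  have hW₁ : ∀ y, o y ∈ A → W y = q '' N := fun y h => if_pos h
  have hW₂ : ∀ y, o y ∉ A → W y = q '' (V (o y) \ A) := fun y h => if_neg h
  have hV : ∀ {y x}, o y ∉ A → q x ∈ W y → x ∈ V (o y) := by
    intro y x hy hx
    rw [hW₂ y hy] at hx
    obtain ⟨z, ⟨hz, hzA⟩, hzx⟩ := hx
    rcases collapseMap_eq_iff.1 hzx with rfl | h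
    · exact hz
    · exact absurd h.1 hzA
  have hlift : ∀ {p} (s : Simplex W p), (∀ i, o (s.1 i) ∉ A) →
      (⋂ i, V (o (s.1 i))).Nonempty := by
    intro p s hs
    obtain ⟨y, hy⟩ := s.2
    rw [Set.mem_iInter] at hy
    exact ⟨o y, Set.mem_iInter.2 fun i => hV (hs i) (by rw [hqo]; exact hy i)⟩
  let e : Cochain W ∅ n := ⟨fun s => if h : ∀ i, o (s.1 i) ∉ A then
      c.1 ⟨fun i => o (s.1 i), hlift s h⟩ else 0, fun s hs => absurd hs.2 (by simp)⟩
  have he₁ : ∀ (s : Simplex W n) (h : ∀ i, o (s.1 i) ∉ A),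
      e.1 s = c.1 ⟨fun i => o (s.1 i), hlift s h⟩ := fun s h => dif_pos h
  have he₂ : ∀ (s : Simplex W n), (∃ i, o (s.1 i) ∈ A) → e.1 s = 0 :=
    fun s ⟨i, hi⟩ => dif_neg fun h => h i hi
  have hemeet : ∀ (s : Simplex W n) (x : X), x ∈ N → (∀ i, q x ∈ W (s.1 i)) → e.1 s = 0 := by
    intro s x hx hs
    by_cases h : ∀ i, o (s.1 i) ∉ A
    · rw [he₁ s h]
      exact hN _ ⟨x, hx, Set.mem_iInter.2 fun i => hV (h i) (hs i)⟩
    · push Not at h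
      exact he₂ s h
  have hec : e ∈ cocycles W ∅ n := by
    rw [LinearMap.mem_ker]
    refine Subtype.ext (funext fun s => ?_)
    change ∑ k : Fin (n + 2), (-1 : ℝ) ^ (k : ℕ) * e.1 (s.face k) = 0
    by_cases h : ∀ i, o (s.1 i) ∉ A
    · have := congrArg (fun d : Cochain V ∅ (n + 1) => d.1 ⟨fun i => o (s.1 i), hlift s h⟩)
        (LinearMap.mem_ker.1 hc)
      refine Eq.trans (Finset.sum_congr rfl fun k _ => ?_) this
      rw [he₁ _ fun i => h _]
      rfl
    · push Not at h
      obtain ⟨i, hi⟩ := h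
      obtain ⟨y, hy⟩ := s.2
      rw [Set.mem_iInter] at hy
      have hyi := hy i
      rw [hW₁ _ hi] at hyi
      obtain ⟨x, hx, rfl⟩ := hyi
      -- A vertex over `A` places the common point in the image of `N`, so every face vanishes, even
      -- the one omitting that vertex.
      exact Finset.sum_eq_zero fun k _ => by rw [hemeet (s.face k) x hx fun j => hy _, mul_zero]
  refine ⟨classOf e hec, ?_⟩
  rw [map, relMap_classOf]
  -- A common refinement of `V` and the pulled-back cover, on which the two cochains agree exactly.
  let T : PointedCover X :=
    { toFun x := V x ∩ W.comap q x
      isOpen' x := (V.isOpen' x).inter ((W.comap q).isOpen' x)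
      mem' x := ⟨V.mem' x, (W.comap q).mem' x⟩ }
  have hVT : V ≤ T := fun x => Set.inter_subset_left
  have hWT : W.comap q ≤ T := fun x => Set.inter_subset_right
  rw [← classOf_refine hVT, ← classOf_refine hWT]
  congr 1
  refine Subtype.ext (funext fun s => ?_)
  change e.1 ((s.map id hWT).map q fun _ => subset_rfl) = c.1 (s.map id hVT)
  by_cases h : ∀ i, s.1 i ∉ A
  · rw [he₁ _ fun i => (hoA _).not.2 (h i)]
    exact congrArg c.1 (Subtype.ext (funext fun i => hoq _ (h i)))
  · push Not at h
    obtain ⟨i, hi⟩ := h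
    rw [he₂ _ ⟨i, (hoA _).2 hi⟩]
    obtain ⟨y, hy⟩ := s.2
    rw [Set.mem_iInter] at hy
    refine (hN _ ⟨y, ?_, Set.mem_iInter.2 fun i => (hy i).1⟩).symm
    have hyi : q y ∈ W (q (s.1 i)) := (hy i).2
    rw [hW₁ _ ((hoA _).2 hi)] at hyi
    obtain ⟨x, hx, hxy⟩ := hyi
    rcases collapseMap_eq_iff.1 hxy with rfl | h
    · exact hx
    · exact hAN h.2

/-- The two maps to `Ȟⁿ(X)` are surjective if each open cover of `X` has a refinement of which at
most `n` members are needed at each point near `A`: `r` maps the indices of a cover `V` to those of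
`U`, and takes at most `n` values on the members of `V` that contain a given point near `A`. -/
theorem surjective_of_small_order {A : Set X} (hA : IsClosed A) {n : ℕ}
    (h : ∀ U : PointedCover X, ∃ (V : PointedCover X) (r : X → X) (N : Set X), U ≤ V ∧ IsOpen N ∧
      A ⊆ N ∧ ∀ y ∈ N, ∃ T : Finset X, T.card ≤ n ∧ ∀ x, y ∈ V x → r x ∈ T ∧ y ∈ U (r x)) :
    Function.Surjective (map (collapseMap X A) n) ∧ Function.Surjective (relToAbs X A n) := by
  have key : ∀ z : Cohomology X n, ∃ (V : PointedCover X) (N : Set X) (c : Cochain V ∅ n)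
      (hc : c ∈ cocycles V ∅ n), IsOpen N ∧ A ⊆ N ∧
      (∀ s : Simplex V n, (N ∩ ⋂ i, V (s.1 i)).Nonempty → c.1 s = 0) ∧ classOf c hc = z := by
    intro z
    obtain ⟨U, c, hc, rfl⟩ := exists_classOf z
    obtain ⟨V, r, N, hUV, hNo, hAN, hN⟩ := h U
    obtain ⟨c', hc', hcc, hv⟩ := exists_cocycle_eq_zero hUV hc r hN
    refine ⟨V, N, c', hc', hNo, hAN, hv, ?_⟩
    rw [← classOf_refine hUV c hc]
    exact (classOf_eq_of_sub_mem _ _ hcc).symm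
  constructor <;> intro z <;> obtain ⟨V, N, c, hc, hNo, hAN, hN, rfl⟩ := key z
  · exact classOf_mem_range_map_collapse hA hNo hAN hc hN
  · exact classOf_mem_range_relToAbs hAN hc hN

end Cech

/-! ### Clopen partitions and shifted grids. -/

open Topology Filter

/-- Cover `S` by finitely many small clopen sets and record which of them contain the point. -/
theorem exists_isLocallyConstant_dist_lt (S : Type*) [MetricSpace S] [CompactSpace S]
    [TotallyDisconnectedSpace S] {δ : ℝ} (hδ : 0 < δ) :
    ∃ κ : S → Set S, IsLocallyConstant κ ∧ ∀ x x', κ x = κ x' → dist x x' < δ := by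
  have (x : S) : ∃ C : Set S, IsClopen C ∧ x ∈ C ∧ C ⊆ Metric.ball x (δ / 2) :=
    compact_exists_isClopen_in_isOpen Metric.isOpen_ball (Metric.mem_ball_self (half_pos hδ))
  choose C hC hxC hCb using this
  obtain ⟨t, ht⟩ := isCompact_univ.elim_finite_subcover C (fun x => (hC x).isOpen)
    fun x _ => Set.mem_iUnion.2 ⟨x, hxC x⟩
  refine ⟨fun x => {i | i ∈ t ∧ x ∈ C i}, (IsLocallyConstant.iff_eventually_eq _).2 fun x => ?_,
    fun x x' h => ?_⟩
  · have : ∀ᶠ x' in 𝓝 x, ∀ i ∈ t, (x' ∈ C i ↔ x ∈ C i) := by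
      rw [eventually_all_finset]
      intro i _
      by_cases hx : x ∈ C i
      · filter_upwards [(hC i).isOpen.mem_nhds hx] with x' hx'
        exact iff_of_true hx' hx
      · filter_upwards [(hC i).compl.isOpen.mem_nhds hx] with x' hx'
        exact iff_of_false hx' hx
    filter_upwards [this] with x' hx'
    ext i
    exact and_congr_right fun hi => hx' i hi
  · obtain ⟨i, hi, hxi⟩ := Set.mem_iUnion₂.1 (ht (Set.mem_univ x))
    have hx'i : x' ∈ C i := ((Set.ext_iff.1 h i).1 ⟨hi, hxi⟩).2
    calc dist x x' ≤ dist x i + dist x' i := dist_triangle_right _ _ _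
      _ < δ / 2 + δ / 2 := add_lt_add (hCb i hxi) (hCb i hx'i)
      _ = δ := add_halves δ

namespace Suspension

variable {n : ℕ} {S : Type*} [AddAction (Fin n → ℤ) S] [TopologicalSpace S]

/-- The point of the suspension with the given representative. -/
abbrev mk (p : S × (Fin n → ℝ)) : Suspension n S := Quotient.mk (suspensionSetoid n S) p

theorem mk_vadd (m : Fin n → ℤ) (x : S) (w : Fin n → ℝ) :
    mk (m +ᵥ x, fun i => w i + (m i : ℝ)) = mk (x, w) :=
  (Quotient.sound (s := suspensionSetoid n S) (a := (x, w)) ⟨m, rfl⟩).symm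

/-- `M` times the `i`-th coordinate, modulo `1`. -/
def coord (M : ℕ) (i : Fin n) : Suspension n S → UnitAddCircle :=
  Quotient.lift (fun p => ((M * p.2 i : ℝ) : UnitAddCircle)) (by
    rintro p _ ⟨m, rfl⟩
    have : ((M * (p.2 i + m i) : ℝ) : UnitAddCircle) =
        ((M * p.2 i : ℝ) : UnitAddCircle) + ((((M : ℤ) * m i : ℤ) : ℝ) : UnitAddCircle) := by
      rw [← AddCircle.coe_add]
      push_cast
      ring_nf
    have h0 : ((((M : ℤ) * m i : ℤ) : ℝ) : UnitAddCircle) = 0 :=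
      (AddCircle.coe_eq_zero_iff 1).2 ⟨M * m i, by simp⟩
    exact (this.trans (by rw [h0, add_zero])).symm)

theorem coord_mk (M : ℕ) (i : Fin n) (p : S × (Fin n → ℝ)) :
    coord M i (mk p) = ((M * p.2 i : ℝ) : UnitAddCircle) := rfl

theorem continuous_coord (M : ℕ) (i : Fin n) : Continuous (coord M i : Suspension n S → _) := by
  refine Continuous.quotient_lift ?_ _
  exact (AddCircle.continuous_mk' 1).comp (by fun_prop)

theorem coord_eq_iff {M : ℕ} {i : Fin n} {p : S × (Fin n → ℝ)} {t : ℝ} :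
    coord M i (mk p) = (t : UnitAddCircle) ↔ ∃ k : ℤ, M * p.2 i - t = k := by
  rw [coord_mk, ← sub_eq_zero, ← AddCircle.coe_sub, AddCircle.coe_eq_zero_iff]
  simp [eq_comm]

theorem mem_skeleton_iff {y : Suspension n S} :
    y ∈ suspensionSkeleton n S ↔ ∃ i, coord 1 i y = 0 := by
  constructor
  · rintro ⟨p, ⟨-, i, k, hk⟩, rfl⟩
    exact ⟨i, (coord_eq_iff (t := 0)).2 ⟨k, by simp [hk]⟩⟩
  · rintro ⟨i, hi⟩
    obtain ⟨p, rfl⟩ := Quotient.exists_rep y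
    obtain ⟨k, hk⟩ := (coord_eq_iff (t := 0)).1 hi
    exact ⟨p, ⟨trivial, i, k, by simpa using hk⟩, rfl⟩

theorem isClosed_skeleton : IsClosed (suspensionSkeleton n S) := by
  have : suspensionSkeleton n S = ⋃ i, coord 1 i ⁻¹' {0} := by
    ext y
    simp [mem_skeleton_iff]
  rw [this]
  exact isClosed_iUnion_of_finite fun i => isClosed_singleton.preimage (continuous_coord 1 i)

theorem exists_coord_eq_zero {y : Suspension n S} (hy : y ∈ suspensionSkeleton n S) (M : ℕ) :
    ∃ i, coord M i y = 0 := by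
  obtain ⟨p, ⟨-, i, k, hk⟩, rfl⟩ := hy
  exact ⟨i, (coord_eq_iff (t := 0)).2 ⟨M * k, by simp [hk]⟩⟩

/-- The points none of whose coordinates is congruent to `t` modulo `1 / M`. -/
def gridComplement (n : ℕ) (S : Type*) [AddAction (Fin n → ℤ) S] [TopologicalSpace S] (M : ℕ)
    (t : ℝ) : Set (Suspension n S) := {y | ∀ i, coord M i y ≠ (t : UnitAddCircle)}

/-- A point that lies on each of the `n` grids shifted by `(k + 1) / (n + 1)` has all its
coordinates congruent to one of these shifts, and thus far from the unshifted grid. -/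
theorem lt_norm_coord_of_notMem {M : ℕ} {y : Suspension n S}
    (hy : ∀ k : Fin n, y ∉ gridComplement n S M ((k + 1) / (n + 1))) (i : Fin n) :
    1 / (2 * (n + 1) : ℝ) < ‖coord M i y‖ := by
  have hn : (0 : ℝ) < n + 1 := by positivity
  have (k : Fin n) : ∃ i, coord M i y = (((k + 1) / (n + 1) : ℝ) : UnitAddCircle) := by
    simpa [gridComplement] using hy k
  choose j hj using this
  have hmul (k : Fin n) : ((k + 1) / (n + 1) : ℝ) * (n + 1) = k + 1 := by field_simp
  -- Distinct shifts differ by a nonzero multiple of `1/(n+1)` smaller than `1`, so no coordinate is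
  -- congruent to two of them.
  have hinj : Function.Injective j := by
    intro k k' h
    have h1 := (hj k).symm.trans ((congrArg (coord M · y) h).trans (hj k'))
    rw [← sub_eq_zero, ← AddCircle.coe_sub, AddCircle.coe_eq_zero_iff] at h1
    obtain ⟨z, hz⟩ := h1
    have h2 : ((z * (n + 1) : ℤ) : ℝ) = ((k - k' : ℤ) : ℝ) := by
      push_cast
      have := hmul k
      have := hmul k'
      rw [zsmul_eq_mul, mul_one] at hz
      rw [hz]
      linarith
    have h3 : z * (n + 1) = (k : ℤ) - k' := by exact_mod_cast h2
    have hk := k.2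
    have hk' := k'.2
    have hz0 : z = 0 := by
      by_contra hne
      rcases lt_or_gt_of_ne hne with h | h
      · nlinarith
      · nlinarith
    subst hz0
    exact Fin.ext (by omega)
  obtain ⟨k, rfl⟩ := (Finite.injective_iff_surjective.1 hinj) i
  rw [hj k, UnitAddCircle.norm_eq]
  set t : ℝ := (k + 1) / (n + 1) with ht
  have hk : (k : ℝ) + 1 ≤ n := by exact_mod_cast k.2
  have hk0 : (0 : ℝ) ≤ k := by positivity
  -- Every shift is at least `1/(n+1)` away from both `0` and `1`; half that bound gives a strict
  -- inequality.
  have h1 : 1 / (n + 1) ≤ t := by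
    rw [ht]; gcongr; linarith
  have h2 : t ≤ 1 - 1 / (n + 1) := by
    rw [ht, le_sub_iff_add_le, ← add_div, div_le_one hn]; linarith
  have h3 : 1 / (2 * (n + 1) : ℝ) < 1 / (n + 1) := by
    gcongr; linarith
  refine h3.trans_le ?_
  rcases le_or_gt (round t) 0 with h | h
  · have : (round t : ℝ) ≤ 0 := by exact_mod_cast h
    exact le_trans (by linarith) (le_abs_self _)
  · have : (1 : ℝ) ≤ round t := by exact_mod_cast h
    exact le_trans (by linarith) (neg_le_abs _)

end Suspension

/-! ### Disjoint open pieces of the grid complement. -/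

namespace Suspension

variable {n : ℕ} {S : Type*} [AddAction (Fin n → ℤ) S]

/-- The index of the cube of side `1 / M` shifted by `t / M` that contains a point. -/
def cube (M : ℕ) (t : ℝ) (w : Fin n → ℝ) : Fin n → ℤ := fun i => ⌊M * w i - t⌋

/-- A function on `S × ℝⁿ` that is invariant under the diagonal action: the point is translated so
that its cube has an index in `[0, M)`, and a function of the translated data is applied. -/
def normalize {K Y : Type*} (κ : S → K) (g : K → (Fin n → ℤ) → Y) (M : ℕ) (t : ℝ)
    (p : S × (Fin n → ℝ)) : Y :=
  g (κ ((fun i => -(cube M t p.2 i / (M : ℤ))) +ᵥ p.1)) fun i => cube M t p.2 i % (M : ℤ)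

/-- Translating by `m` adds `M * m` to the cube index: the remainder is unchanged and the change in
the quotient cancels the action on `S`. -/
theorem normalize_vadd {K Y : Type*} (κ : S → K) (g : K → (Fin n → ℤ) → Y) {M : ℕ} (hM : M ≠ 0)
    (t : ℝ) (m : Fin n → ℤ) (p : S × (Fin n → ℝ)) :
    normalize κ g M t (m +ᵥ p.1, fun i => p.2 i + (m i : ℝ)) = normalize κ g M t p := by
  have hc : ∀ i, cube M t (fun i => p.2 i + (m i : ℝ)) i = cube M t p.2 i + M * m i := by
    intro i
    rw [cube, cube, ← Int.floor_add_intCast]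
    push_cast
    ring_nf
  have hM' : (M : ℤ) ≠ 0 := by exact_mod_cast hM
  unfold normalize
  simp only [hc, Int.add_mul_emod_self_left, Int.add_mul_ediv_left _ _ hM', vadd_vadd]
  congr 3
  ext i
  simp

variable [TopologicalSpace S]

/-- Off the grid the cube index is locally constant, and so is `κ` after a fixed translation. -/
theorem isOpen_normalize_eq [ContinuousConstVAdd (Fin n → ℤ) S] {K Y : Type*} {κ : S → K}
    (hκ : IsLocallyConstant κ) (g : K → (Fin n → ℤ) → Y) (M : ℕ) (t : ℝ) (z : Y) :
    IsOpen {p : S × (Fin n → ℝ) | (∀ i, ∀ k : ℤ, M * p.2 i - t ≠ k) ∧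
      normalize κ g M t p = z} := by
  rw [isOpen_iff_eventually]
  rintro p ⟨hp, rfl⟩
  have h₁ : ∀ᶠ q in 𝓝 p, ∀ i, ((cube M t p.2 i : ℤ) : ℝ) < M * q.2 i - t ∧
      M * q.2 i - t < cube M t p.2 i + 1 := by
    rw [eventually_all]
    intro i
    have hcont : Continuous fun q : S × (Fin n → ℝ) => M * q.2 i - t := by fun_prop
    refine hcont.continuousAt.eventually (Ioo_mem_nhds ?_ (Int.lt_floor_add_one _))
    exact lt_of_le_of_ne (Int.floor_le _) (hp i _).symm
  have h₂ : ∀ᶠ q in 𝓝 p, κ ((fun i => -(cube M t p.2 i / (M : ℤ))) +ᵥ q.1) =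
      κ ((fun i => -(cube M t p.2 i / (M : ℤ))) +ᵥ p.1) := by
    have hcont : Continuous fun q : S × (Fin n → ℝ) =>
      (fun i => -(cube M t p.2 i / (M : ℤ))) +ᵥ q.1 := continuous_fst.const_vadd _
    exact hcont.continuousAt.eventually ((IsLocallyConstant.iff_eventually_eq κ).1 hκ _)
  filter_upwards [h₁, h₂] with q hq₁ hq₂
  have hcq : cube M t q.2 = cube M t p.2 :=
    funext fun i => Int.floor_eq_iff.2 ⟨(hq₁ i).1.le, (hq₁ i).2⟩
  refine ⟨fun i k hk => ?_, ?_⟩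
  · obtain ⟨ha, hb⟩ := hq₁ i
    rw [hk] at ha hb
    have ha' : cube M t p.2 i < k := by exact_mod_cast ha
    have hb' : k < cube M t p.2 i + 1 := by exact_mod_cast hb
    omega
  · unfold normalize
    rw [hcq, hq₂]

theorem mk_mem_gridComplement_iff {M : ℕ} {t : ℝ} {p : S × (Fin n → ℝ)} :
    mk p ∈ gridComplement n S M t ↔ ∀ i, ∀ k : ℤ, M * p.2 i - t ≠ k := by
  simp [gridComplement, coord_eq_iff]

/-- The complement of each translate of a sufficiently fine grid decomposes into disjoint open
pieces subordinate to a given cover. -/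
theorem exists_piece [Nonempty S] [ContinuousConstVAdd (Fin n → ℤ) S] {K : Type*} {κ : S → K}
    (hκ : IsLocallyConstant κ) {M : ℕ} (hM : M ≠ 0) {t : ℝ}
    (U : Suspension n S → Set (Suspension n S))
    (hU : ∀ (c : K) (b : Fin n → ℤ), (∀ i, 0 ≤ b i ∧ b i < M) → ∃ z, ∀ x w, κ x = c →
      (∀ i, (b i : ℝ) ≤ M * w i - t ∧ M * w i - t < b i + 1) → mk (x, w) ∈ U z) :
    ∃ f : Suspension n S → Suspension n S, (∀ y, y ∈ U (f y)) ∧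
      ∀ z, IsOpen {y | y ∈ gridComplement n S M t ∧ f y = z} := by
  have (c : K) (b : Fin n → ℤ) : ∃ z, (∀ i, 0 ≤ b i ∧ b i < M) → ∀ x w, κ x = c →
      (∀ i, (b i : ℝ) ≤ M * w i - t ∧ M * w i - t < b i + 1) → mk (x, w) ∈ U z := by
    by_cases hb : ∀ i, 0 ≤ b i ∧ b i < M
    · exact (hU c b hb).imp fun z hz _ => hz
    · exact ⟨mk (Classical.arbitrary S, 0), fun h => absurd h hb⟩
  choose g hg using this
  have hM' : (0 : ℤ) < M := by exact_mod_cast Nat.pos_of_ne_zero hM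
  refine ⟨Quotient.lift (normalize κ g M t) (by
    rintro p _ ⟨m, rfl⟩
    exact (normalize_vadd κ g hM t m p).symm), fun y => ?_, fun z => ?_⟩
  · obtain ⟨⟨x, w⟩, rfl⟩ := Quotient.exists_rep y
    set m : Fin n → ℤ := fun i => -(cube M t w i / (M : ℤ)) with hm
    have h := hg (κ (m +ᵥ x)) (fun i => cube M t w i % (M : ℤ))
      (fun i => ⟨Int.emod_nonneg _ hM'.ne', Int.emod_lt_of_pos _ hM'⟩) (m +ᵥ x)
      (fun i => w i + (m i : ℝ)) rfl fun i => ?_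
    · rw [mk_vadd] at h
      exact h
    · have h₁ : (cube M t w i : ℝ) ≤ M * w i - t := Int.floor_le _
      have h₂ : M * w i - t < cube M t w i + 1 := Int.lt_floor_add_one _
      have h₃ : ((cube M t w i % (M : ℤ) : ℤ) : ℝ) = cube M t w i + M * m i := by
        rw [Int.emod_def, hm]
        push_cast
        ring
      rw [h₃]
      constructor <;> linarith
  · refine (isQuotientMap_quotient_mk' (s := suspensionSetoid n S)).isOpen_preimage.1 ?_
    convert isOpen_normalize_eq hκ g M t z using 1
    ext p
    exact and_congr_left fun _ => mk_mem_gridComplement_iff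

end Suspension

/-- Near `A`, a member of `V` lies in one piece of one of the `n` grid complements, and `r` names a
member of `U` containing that piece. -/
theorem Suspension.exists_refinement {n : ℕ} {S : Type*} [MetricSpace S] [CompactSpace S]
    [TotallyDisconnectedSpace S] [Nonempty S] [AddAction (Fin n → ℤ) S]
    [ContinuousConstVAdd (Fin n → ℤ) S] (U : Cech.PointedCover (Suspension n S)) :
    ∃ (V : Cech.PointedCover (Suspension n S)) (r : Suspension n S → Suspension n S)
      (N : Set (Suspension n S)), U ≤ V ∧ IsOpen N ∧ suspensionSkeleton n S ⊆ N ∧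
      ∀ y ∈ N, ∃ T : Finset (Suspension n S), T.card ≤ n ∧
        ∀ x, y ∈ V x → r x ∈ T ∧ y ∈ U (r x) := by
  classical
  have hn : (0 : ℝ) < n + 1 := by positivity
  -- The compact set `S × [0,1]ⁿ` contains the lower corner of every normalized cube; the cubes
  -- themselves may protrude, since Lebesgue balls are taken in `S × ℝⁿ`.
  obtain ⟨δ, hδ, hleb⟩ := lebesgue_number_lemma_of_metric
    (isCompact_univ.prod (isCompact_Icc (a := (0 : Fin n → ℝ)) (b := 1)))
    (c := fun z => (Suspension.mk ⁻¹' U z : Set (S × (Fin n → ℝ))))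
    (fun z => (U.isOpen' z).preimage continuous_quotient_mk')
    (fun p _ => Set.mem_iUnion.2 ⟨Suspension.mk p, U.mem' _⟩)
  obtain ⟨κ, hκ, hκδ⟩ := exists_isLocallyConstant_dist_lt S hδ
  obtain ⟨M, hMδ⟩ := exists_nat_gt (1 / δ)
  have hM0 : (0 : ℝ) < M := (one_div_pos.2 hδ).trans hMδ
  have hM : M ≠ 0 := by rintro rfl; simp at hM0
  have hfine (k : Fin n) := Suspension.exists_piece hκ hM (t := (k + 1) / (n + 1)) U.toFun (by
    intro c b hb
    have ht0 : (0 : ℝ) ≤ (k + 1) / (n + 1) := by positivity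
    have ht1 : ((k : ℝ) + 1) / (n + 1) ≤ 1 := by
      rw [div_le_one hn]
      have : (k : ℝ) ≤ n := by exact_mod_cast k.2.le
      linarith
    set t : ℝ := (k + 1) / (n + 1)
    by_cases hc : ∃ x, κ x = c
    · obtain ⟨x₀, rfl⟩ := hc
      have hmem : (fun i => (b i + t) / M) ∈ Set.Icc (0 : Fin n → ℝ) 1 := by
        refine ⟨fun i => ?_, fun i => ?_⟩
        · have : (0 : ℝ) ≤ b i := by exact_mod_cast (hb i).1
          exact div_nonneg (by linarith) hM0.le
        · have : (b i : ℝ) + 1 ≤ M := by exact_mod_cast (hb i).2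
          exact (div_le_one hM0).2 (by linarith)
      obtain ⟨z, hz⟩ := hleb (x₀, fun i => (b i + t) / M) ⟨trivial, hmem⟩
      refine ⟨z, fun x w hx hw => hz ?_⟩
      rw [Metric.mem_ball, Prod.dist_eq, max_lt_iff, dist_pi_lt_iff hδ]
      refine ⟨hκδ _ _ hx, fun i => ?_⟩
      have hw' : w i - (b i + t) / M = (M * w i - t - b i) / M := by field_simp; ring
      rw [Real.dist_eq, hw', abs_of_nonneg (div_nonneg (by linarith [(hw i).1]) hM0.le),
        div_lt_iff₀ hM0]
      rw [div_lt_iff₀ hδ] at hMδ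
      linarith [(hw i).2]
    · exact ⟨Suspension.mk (Classical.arbitrary S, 0), fun x _ hx => absurd ⟨x, hx⟩ hc⟩)
  choose f hfU hfo using hfine
  let Ω (k : Fin n) := Suspension.gridComplement n S M ((k + 1) / (n + 1))
  -- `W` contains every point missed by all `n` families and is disjoint from `N`, so it does not
  -- count near `A`.
  let W : Set (Suspension n S) := {y | ∀ i, 1 / (2 * (n + 1) : ℝ) < ‖Suspension.coord M i y‖}
  let N : Set (Suspension n S) := {y | ∃ i, ‖Suspension.coord M i y‖ < 1 / (2 * (n + 1) : ℝ)}
  have hW : IsOpen W := by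
    simp only [W, Set.ofPred_forall]
    exact isOpen_iInter_of_finite fun i =>
      isOpen_lt continuous_const (Suspension.continuous_coord M i).norm
  have hN : IsOpen N := by
    simp only [N, Set.ofPred_exists]
    exact isOpen_iUnion fun i =>
      isOpen_lt (Suspension.continuous_coord M i).norm continuous_const
  have hchoice (x : Suspension n S) : ∃ O : Set (Suspension n S), ∃ z, IsOpen O ∧ x ∈ O ∧
      ∀ y ∈ N, y ∈ O → (∃ k, f k y = z) ∧ y ∈ U z := by
    by_cases hx : ∃ k, x ∈ Ω k
    · obtain ⟨k, hk⟩ := hx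
      refine ⟨_, f k x, hfo k (f k x), ⟨hk, rfl⟩, ?_⟩
      rintro y - ⟨-, hy⟩
      exact ⟨⟨k, hy⟩, hy ▸ hfU k y⟩
    · push Not at hx
      -- The value `x` of `r` is arbitrary here, as `W` does not meet `N`.
      refine ⟨W, x, hW, Suspension.lt_norm_coord_of_notMem hx, ?_⟩
      rintro y ⟨i, hi⟩ hy
      exact absurd hi (hy i).not_gt
  choose O r hOo hxO hOr using hchoice
  refine ⟨⟨fun x => U x ∩ O x, fun x => (U.isOpen' x).inter (hOo x), fun x => ⟨U.mem' x, hxO x⟩⟩,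
    r, N, fun x => Set.inter_subset_left, hN, fun y hy => ?_, fun y hy => ?_⟩
  · obtain ⟨i, hi⟩ := Suspension.exists_coord_eq_zero hy M
    exact ⟨i, by rw [hi, norm_zero]; positivity⟩
  -- One value for each of the `n` shifted grids.
  · refine ⟨Finset.univ.image fun k => f k y, Finset.card_image_le.trans (by simp), fun x hx => ?_⟩
    obtain ⟨⟨k, hk⟩, hU⟩ := hOr x y hy hx.2
    exact ⟨Finset.mem_image.2 ⟨k, Finset.mem_univ k, hk⟩, hU⟩

end

theorem mainTheorem8 (n : ℕ) {S : Type*} [MetricSpace S] [CompactSpace S]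
    [TotallyDisconnectedSpace S] [PerfectSpace S] [Nonempty S]
    [AddAction (Fin n → ℤ) S] [ContinuousConstVAdd (Fin n → ℤ) S]
    (hfree : ∀ (m : Fin n → ℤ) (x : S), m +ᵥ x = x → m = 0)
    (hmin : ∀ x : S, Dense (AddAction.orbit (Fin n → ℤ) x)) :
    Function.Surjective
      (Cech.map (collapseMap (Suspension n S) (suspensionSkeleton n S)) n) ∧
    Function.Surjective
      (Cech.relToAbs (Suspension n S) (suspensionSkeleton n S) n) :=
  Cech.surjective_of_small_order Suspension.isClosed_skeleton Suspension.exists_refinement
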